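/- Let $G=(V,E)$ be a tree on $k\ge 1$ vertices. Choose an orientation of its edges and let $E'\subseteq V\times V$ be the resulting set of ordered pairs. Every $e=(x,y)\in E'$ acts on finite words over the alphabet $V$ by $e\cdot\emptyset=\emptyset$ and $$ e\cdot(xw)=y\,(e\cdot w),\qquad e\cdot(yw)=xw,\qquad e\cdot(zw)=zw\quad(z\in V\setminus\{x,y\}), $$ and the identity state $id$ acts trivially. (These are the states of the tree automaton of $G$; they generate its automaton group.) For $n\ge 1$ let $\Gamma_n^G$ be the $n$-th Schreier graph: its vertex set is $V^n$, the set of words of length $n$, and each $u\in V^n$ is joined to $q\cdot u$ by an edge labelled $q$, for every $q\in E'\cup\{id\}$ (loops and multiple edges are allowed). For a finite connected graph $\Gamma$ let $$ W(\Gamma)=\frac12\sum_{u,v\in V(\Gamma)}d_\Gamma(u,v) $$ be its Wiener index (the sum of the distances over all unordered pairs of vertices). Then, for every $n\ge 1$ and every choice of the orientation, $\Gamma_n^G$ is connected and $$ \begin{aligned} W(\Gamma_n^G) ={}& \frac{(k-1)^2(2k^2-2k-1)}{k^3(2k-1)}\cdot 2^n k^{2n} - \frac{2(k-1)^2}{k^2}\cdot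 n k^{2n} + \frac{2(k+1)(k-1)}{k^3}\cdot k^{2n} - \frac{2(k+1)(k-1)}{k(2k-1)}\cdot k^n\\ &+ \left(\frac{2}{k^2}\cdot n k^{2n} - \frac{k^2+2}{k^3(k-1)}\cdot k^{2n} + \frac{k+2}{k^2(k-1)}\cdot k^n\right) W(G). \end{aligned} $$ For $k=1$, where $W(G)=0$, the last summand is read as $0$. -/

import Mathlib

/-- An automaton (transducer) with state set `Q` and alphabet `X`. -/
structure Transducer (Q X : Type*) where
  /-- the restriction map `λ` -/
  restrict : Q → X → Q
  /-- the output map `η` -/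
  output : Q → X → X

namespace Transducer

variable {Q X : Type*}

/-- The action `η(q, ·)` of a state on finite words:
`η(q, x w) = η(q, x) η(λ(q, x), w)`. -/
def act (A : Transducer Q X) : Q → List X → List X
  | _, [] => []
  | q, x :: w => A.output q x :: A.act (A.restrict q x) w

theorem length_act (A : Transducer Q X) (q : Q) (w : List X) :
    (A.act q w).length = w.length := by
  induction w generalizing q with
  | nil => rfl
  | cons x w ih => simp [act, ih]

/-- The action of a state on the set `X ^ n` of words of length `n`. -/
def actWord (A : Transducer Q X) (n : ℕ) (q : Q) (w : List.Vector X n) : List.Vector X n :=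
  ⟨A.act q w.1, (A.length_act q w.1).trans w.2⟩

/-- The `n`-th Schreier graph of the action generated by the states of `A`: an undirected
multigraph with vertex set `X ^ n` and, for every state `q` and every word `u` of length `n`,
one edge (possibly a loop) labelled `q` that joins `u` and `η(q, u)`. -/
def schreierGraph (A : Transducer Q X) (n : ℕ) :
    Graph (List.Vector X n) (Q × List.Vector X n) where
  vertexSet := Set.univ
  IsLink e u v := (u = e.2 ∧ v = A.actWord n e.1 e.2) ∨ (v = e.2 ∧ u = A.actWord n e.1 e.2)
  isLink_symm _ _ := ⟨fun _ _ h => h.symm⟩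
  eq_or_eq_of_isLink_of_isLink := by
    rintro e x y v w (⟨h1, h2⟩ | ⟨h1, h2⟩) (⟨h3, h4⟩ | ⟨h3, h4⟩)
    · exact Or.inl (h1.trans h3.symm)
    · exact Or.inr (h1.trans h3.symm)
    · exact Or.inr (h2.trans h4.symm)
    · exact Or.inl (h2.trans h4.symm)
  left_mem_of_isLink := fun _ _ _ _ => Set.mem_univ _

/-- The simple graph underlying the `n`-th Schreier graph (loops are dropped and parallel edges
are merged, which does not affect distances). -/
def simpleSchreierGraph (A : Transducer Q X) (n : ℕ) : SimpleGraph (List.Vector X n) :=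
  SimpleGraph.fromRel (A.schreierGraph n).Adj

end Transducer

/-- An orientation of `G`: a set of ordered pairs that contains, for every edge `{x, y}` of `G`,
exactly one of `(x, y)` and `(y, x)`, and nothing else. -/
structure GraphOrientation {V : Type*} (G : SimpleGraph V) where
  /-- the set of oriented edges -/
  arcs : Set (V × V)
  adj_of_mem : ∀ ⦃x y⦄, (x, y) ∈ arcs → G.Adj x y
  mem_of_adj : ∀ ⦃x y⦄, G.Adj x y → Xor ((x, y) ∈ arcs) ((y, x) ∈ arcs)

/-- The automaton of an oriented graph. Its states are the oriented edges and the sink `none`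
(the identity state); its alphabet is the vertex set. -/
def graphAutomaton {V : Type*} [DecidableEq V] {G : SimpleGraph V} (o : GraphOrientation G) :
    Transducer (Option o.arcs) V where
  restrict
    | none, _ => none
    | some e, z => if z = e.1.1 then some e else none
  output
    | none, z => z
    | some e, z => if z = e.1.1 then e.1.2 else if z = e.1.2 then e.1.1 else z

/-- The Wiener index of a finite connected graph: the sum of the distances over all unordered
pairs of vertices, that is, half the sum over all ordered pairs. -/
noncomputable def wienerIndex {V : Type*} [Fintype V] (G : SimpleGraph V) : ℚ :=
  (1 / 2) * ∑ u, ∑ v, (G.dist u v : ℚ)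

/-!
`Γ_n` is a cactus: for every edge `a` of the tree and every word `s` shorter than `n` whose first
letter is not an endpoint of `a`, the words `q s` with `q` in the endpoints of `a` form a cycle of
length `2 ^ (n - |s|)`, on which the state `a` acts as a binary odometer. Moving along one of these
cycles changes the projection to no other cycle, so the distance of two words is the sum, over all
cycles, of the cyclic distances of their projections. The distances in the tree itself obey the same
rule, with cycles of length `2`.

The Wiener index is then summed cycle by cycle. The words `w x` and `w y`, where `x` and `y` are the
endpoints of `a`, have antipodal positions on the cycle of `a` with empty suffix, so their distances
to any third position add up to half the length of the cycle; the words `w z` with `z` not an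
endpoint of `a` all sit at one of the two adjacent positions `0 ⋯ 0` and `1 ⋯ 1`, according to the
side of `a` on which `z` lies. Hence only the products of the numbers of vertices on the two sides
of an edge enter, and their sum over all edges is the Wiener index of the tree. A cycle with suffix
`z t` is a copy of a shorter cycle with empty suffix to which every word that does not end in `z t`
projects as `z ⋯ z`.
-/

namespace TreeSchreier

section CycleDist

variable {N : ℕ}

/-- The distance of two vertices of the cycle of length `N`, whose vertex set is `ZMod N`. -/
def cycleDist (i j : ZMod N) : ℕ := (i - j).valMinAbs.natAbs

theorem cycleDist_self (i : ZMod N) : cycleDist i i = 0 := by simp [cycleDist]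

theorem cycleDist_comm (i j : ZMod N) : cycleDist i j = cycleDist j i := by
  rw [cycleDist, ← neg_sub, ZMod.natAbs_valMinAbs_neg, cycleDist]

theorem cycleDist_triangle (i j l : ZMod N) : cycleDist i l ≤ cycleDist i j + cycleDist j l := by
  have := ZMod.natAbs_valMinAbs_add_le (i - j) (j - l)
  rw [sub_add_sub_cancel] at this
  exact this.trans (Int.natAbs_add_le _ _)

theorem natAbs_valMinAbs_intCast_le (x : ℤ) : (x : ZMod N).valMinAbs.natAbs ≤ x.natAbs := by
  cases N with
  | zero => exact le_rfl
  | succ N =>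
    exact ZMod.natAbs_min_of_le_div_two (N + 1) _ _ (ZMod.coe_valMinAbs _)
      (ZMod.natAbs_valMinAbs_le _)

theorem cycleDist_add_one_self_le (i : ZMod N) : cycleDist (i + 1) i ≤ 1 := by
  simpa [cycleDist] using natAbs_valMinAbs_intCast_le (N := N) 1

theorem cycleDist_sub_one_self_le (i : ZMod N) : cycleDist (i - 1) i ≤ 1 := by
  simpa [cycleDist] using natAbs_valMinAbs_intCast_le (N := N) (-1)

theorem cycleDist_add_one_lt_or_sub_one_lt {i j : ZMod N} (h : i ≠ j) :
    cycleDist (i + 1) j < cycleDist i j ∨ cycleDist (i - 1) j < cycleDist i j := by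
  set x := (i - j).valMinAbs
  have hne : x ≠ 0 := fun h0 => h (sub_eq_zero.1 ((ZMod.valMinAbs_eq_zero _).1 h0))
  have hij : i - j = (x : ℤ) := (ZMod.coe_valMinAbs _).symm
  have hadd : cycleDist (i + 1) j ≤ (x + 1).natAbs := by
    have := natAbs_valMinAbs_intCast_le (N := N) (x + 1)
    rwa [Int.cast_add, ← hij, Int.cast_one, sub_add_eq_add_sub] at this
  have hsub : cycleDist (i - 1) j ≤ (x - 1).natAbs := by
    have := natAbs_valMinAbs_intCast_le (N := N) (x - 1)
    rwa [Int.cast_sub, ← hij, Int.cast_one, sub_right_comm] at this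
  have : cycleDist i j = x.natAbs := rfl
  omega

theorem cycleDist_add_cycleDist_antipode {M : ℕ} (hN : N = 2 * M) (hM : 0 < M) (i j : ZMod N) :
    cycleDist i j + cycleDist (i + (M : ZMod N)) j = M := by
  subst hN
  have : NeZero (2 * M) := ⟨by omega⟩
  simp only [cycleDist, ZMod.valMinAbs_natAbs_eq_min, sub_eq_add_neg]
  rw [add_right_comm]
  generalize i + -j = d
  have hval : (d + (M : ZMod (2 * M))).val = (d.val + M) % (2 * M) := by
    rw [ZMod.val_add, ZMod.val_natCast, Nat.mod_eq_of_lt (a := M) (by omega)]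
  have := d.val_lt
  rw [hval]
  rcases lt_or_ge d.val M with h | h
  · rw [Nat.mod_eq_of_lt (by omega)]
    omega
  · rw [Nat.mod_eq_sub_mod (by omega), Nat.mod_eq_of_lt (by omega)]
    omega

end CycleDist

section Distance

variable {W : Type*} [Nonempty W] (H : SimpleGraph W)

theorem connected_and_dist_eq (D : W → W → ℕ) (h_self : ∀ v, D v v = 0)
    (h_adj : ∀ u u' v, H.Adj u u' → D u v ≤ D u' v + 1)
    (h_move : ∀ u v, u ≠ v → ∃ u', H.Adj u u' ∧ D u' v < D u v) :
    H.Connected ∧ ∀ u v, H.dist u v = D u v := by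
  have exists_walk (u v : W) : ∃ p : H.Walk u v, p.length ≤ D u v := by
    induction hm : D u v using Nat.strong_induction_on generalizing u with
    | _ m ih =>
      subst hm
      by_cases huv : u = v
      · subst huv
        exact ⟨.nil, Nat.zero_le _⟩
      · obtain ⟨u', hadj, hlt⟩ := h_move u v huv
        obtain ⟨p, hp⟩ := ih _ hlt u' rfl
        exact ⟨.cons hadj p, by rw [SimpleGraph.Walk.length_cons]; omega⟩
  have le_length {u v : W} (p : H.Walk u v) : D u v ≤ p.length := by
    induction p with
    | nil => rw [h_self]; exact Nat.zero_le _
    | cons hadj p ih =>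
      rw [SimpleGraph.Walk.length_cons]
      exact (h_adj _ _ _ hadj).trans (by omega)
  have hconn : H.Connected := ⟨fun u v => let ⟨p, _⟩ := exists_walk u v; ⟨p⟩⟩
  refine ⟨hconn, fun u v => le_antisymm ?_ ?_⟩
  · obtain ⟨p, hp⟩ := exists_walk u v
    exact (H.dist_le p).trans hp
  · obtain ⟨p, hp⟩ := hconn.exists_walk_length_eq_dist u v
    exact hp ▸ le_length p

variable {ι : Type*} [Fintype ι] {N : ι → ℕ} (π : W → ∀ i, ZMod (N i))

theorem connected_and_dist_eq_sum_cycleDist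
    (h_adj : ∀ u v, H.Adj u v →
      ∃ i, (π v i = π u i + 1 ∨ π v i = π u i - 1) ∧ ∀ j ≠ i, π v j = π u j)
    (h_move : ∀ u v, u ≠ v → ∃ i, π u i ≠ π v i ∧
      (∃ u', H.Adj u u' ∧ π u' i = π u i + 1) ∧ ∃ u', H.Adj u u' ∧ π u' i = π u i - 1) :
    H.Connected ∧ ∀ u v, H.dist u v = ∑ i, cycleDist (π u i) (π v i) := by
  classical
  have sum_add_cycleDist (i : ι) {u u' : W} (hj : ∀ j ≠ i, π u' j = π u j) (v : W) :
      (∑ j, cycleDist (π u j) (π v j)) + cycleDist (π u' i) (π v i) =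
        (∑ j, cycleDist (π u' j) (π v j)) + cycleDist (π u i) (π v i) := by
    rw [← Finset.add_sum_erase _ _ (Finset.mem_univ i),
      ← Finset.add_sum_erase _ (fun j => cycleDist (π u' j) (π v j)) (Finset.mem_univ i),
      Finset.sum_congr rfl fun j h => by rw [← hj j (Finset.ne_of_mem_erase h)]]
    ring
  refine connected_and_dist_eq H (fun u v => ∑ i, cycleDist (π u i) (π v i))
    (fun v => Finset.sum_eq_zero fun i _ => cycleDist_self _) ?_ ?_
  · intro u u' v hadj
    obtain ⟨i, hi, hj⟩ := h_adj u u' hadj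
    have hstep : cycleDist (π u i) (π u' i) ≤ 1 := by
      rw [cycleDist_comm]
      rcases hi with hi | hi <;> rw [hi]
      exacts [cycleDist_add_one_self_le _, cycleDist_sub_one_self_le _]
    have := cycleDist_triangle (π u i) (π u' i) (π v i)
    have := sum_add_cycleDist i hj v
    omega
  · intro u v huv
    obtain ⟨i, hne, hadd, hsub⟩ := h_move u v huv
    obtain ⟨u', hadj, hlt⟩ : ∃ u', H.Adj u u' ∧
        cycleDist (π u' i) (π v i) < cycleDist (π u i) (π v i) := by
      rcases cycleDist_add_one_lt_or_sub_one_lt hne with hlt | hlt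
      · exact hadd.imp fun u' ⟨hadj, h⟩ => ⟨hadj, h ▸ hlt⟩
      · exact hsub.imp fun u' ⟨hadj, h⟩ => ⟨hadj, h ▸ hlt⟩
    obtain ⟨i', -, hj⟩ := h_adj u u' hadj
    obtain rfl : i = i' := by
      by_contra h
      rw [hj i h] at hlt
      exact lt_irrefl _ hlt
    have := sum_add_cycleDist i hj v
    exact ⟨u', hadj, by omega⟩

end Distance

section Bits

/-- The integer modulo `2 ^ n` with a given list of binary digits, least significant digit
first. -/
def ofBits (n : ℕ) (l : List Bool) : ZMod (2 ^ n) := (Nat.ofDigits 2 (l.map Bool.toNat) : ℕ)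

theorem ofBits_cons (n : ℕ) (b : Bool) (l : List Bool) :
    ofBits n (b :: l) = b.toNat + 2 * ofBits n l := by
  simp [ofBits, Nat.ofDigits_cons]

theorem ofBits_append (n : ℕ) (l l' : List Bool) :
    ofBits n (l ++ l') = ofBits n l + 2 ^ l.length * ofBits n l' := by
  simp [ofBits, Nat.ofDigits_append]

theorem ofBits_replicate_false (n m : ℕ) : ofBits n (List.replicate m false) = 0 := by
  induction m with
  | zero => simp [ofBits]
  | succ m ih => rw [List.replicate_succ, ofBits_cons, ih]; simp

theorem ofBits_replicate_true (n m : ℕ) : ofBits n (List.replicate m true) = 2 ^ m - 1 := by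
  induction m with
  | zero => simp [ofBits]
  | succ m ih => rw [List.replicate_succ, ofBits_cons, ih, Bool.toNat_true]; push_cast; ring

theorem two_pow_eq_zero (n : ℕ) : (2 ^ n : ZMod (2 ^ n)) = 0 := by
  exact_mod_cast ZMod.natCast_self (2 ^ n)

theorem eq_of_ofBits_eq {n : ℕ} {l l' : List Bool} (hl : l.length = n) (hl' : l'.length = n)
    (h : ofBits n l = ofBits n l') : l = l' := by
  have digits_lt (l : List Bool) : ∀ d ∈ l.map Bool.toNat, d < 2 := by
    intro d hd
    obtain ⟨b, -, rfl⟩ := List.mem_map.1 hd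
    exact b.toNat_lt
  have ofDigits_lt {l : List Bool} (hl : l.length = n) :
      Nat.ofDigits 2 (l.map Bool.toNat) < 2 ^ n := by
    simpa [hl] using Nat.ofDigits_lt_base_pow_length one_lt_two (digits_lt l)
  rw [ofBits, ofBits, ZMod.natCast_eq_natCast_iff', Nat.mod_eq_of_lt (ofDigits_lt hl),
    Nat.mod_eq_of_lt (ofDigits_lt hl')] at h
  exact List.map_injective_iff.2 (fun b b' => by cases b <;> cases b' <;> simp)
    (Nat.ofDigits_inj_of_len_eq one_lt_two (by simp [hl, hl']) (digits_lt l) (digits_lt l') h)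

end Bits

section GateBits

variable {V : Type*} (p side : V → Bool)

/-- The bits of a word with respect to a gate (the letters that satisfy `p`) and a two-sided
partition `side` of the alphabet: a letter that is followed by gate letters only contributes its
own side, and every earlier letter copies the bit of the last letter outside the gate. If `p` and
`side` come from an edge of a tree, this reads off the position of the word in the large cycle of
that edge, or of the vertex of the large cycle where the word is attached. -/
def gateBits : List V → List Bool
  | [] => []
  | x :: w => (if w.all p then side x else (gateBits w).headI) :: gateBits w

variable {p side}

@[simp]
theorem length_gateBits (w : List V) : (gateBits p side w).length = w.length := by
  induction w with
  | nil => rfl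
  | cons x w ih => rw [gateBits, List.length_cons, List.length_cons, ih]

theorem gateBits_suffix_gateBits_append (q r : List V) :
    gateBits p side r <:+ gateBits p side (q ++ r) := by
  induction q with
  | nil => exact List.suffix_rfl
  | cons x q ih => exact ih.trans (List.suffix_cons _ _)

theorem gateBits_of_all {w : List V} (h : w.all p) : gateBits p side w = w.map side := by
  induction w with
  | nil => rfl
  | cons x w ih =>
    rw [List.all_cons, Bool.and_eq_true] at h
    rw [gateBits, if_pos h.2, ih h.2, List.map_cons]

theorem eq_of_gateBits_eq (hside : ∀ x y, p x → p y → side x = side y → x = y) {w w' : List V}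
    (hw : w.all p) (hw' : w'.all p) (h : gateBits p side w = gateBits p side w') : w = w' := by
  rw [gateBits_of_all hw, gateBits_of_all hw'] at h
  induction w generalizing w' with
  | nil => exact (List.map_eq_nil_iff.1 h.symm).symm
  | cons x w ih =>
    obtain ⟨y, w', rfl, hxy, hww'⟩ := List.map_eq_cons_iff.1 h.symm
    rw [List.all_cons, Bool.and_eq_true] at hw hw'
    rw [hside x y hw.1 hw'.1 hxy.symm, ih hw.2 hw'.2 hww'.symm]

theorem gateBits_append_of_all {r : List V} (h : r.all p) (q : List V) :
    gateBits p side (q ++ r) = gateBits p side q ++ gateBits p side r := by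
  induction q with
  | nil => rfl
  | cons x q ih =>
    rw [List.cons_append, gateBits, gateBits, ih, List.all_append, h, Bool.and_true,
      List.cons_append]
    cases q with
    | nil => rfl
    | cons y q => rfl

theorem gateBits_append_of_not_all {r : List V} (h : ¬ r.all p) (q : List V) :
    gateBits p side (q ++ r) =
      List.replicate q.length (gateBits p side r).headI ++ gateBits p side r := by
  induction q with
  | nil => rfl
  | cons x q ih =>
    have hqr : ¬ (q ++ r).all p := by
      rw [List.all_append, Bool.and_eq_true]
      exact fun h' => h h'.2
    rw [List.cons_append, gateBits, if_neg hqr, ih, List.length_cons, List.replicate_succ,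
      List.cons_append]
    cases q <;> rfl

theorem gateBits_concat {z : V} (hz : ¬ p z) (w : List V) :
    gateBits p side (w ++ [z]) = List.replicate (w.length + 1) (side z) := by
  rw [gateBits_append_of_not_all (by simpa using hz), List.replicate_succ']
  rfl

theorem gateBits_eq_replicate {w : List V} {b : Bool} (h : ∀ x ∈ w, side x = b) :
    gateBits p side w = List.replicate w.length b := by
  induction w with
  | nil => rfl
  | cons x w ih =>
    obtain ⟨hx, hw⟩ := List.forall_mem_cons.1 h
    rw [gateBits, ih hw, hx, List.length_cons, List.replicate_succ]
    cases w <;> simp [List.replicate_succ]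

theorem gateBits_replicate (m : ℕ) (x : V) :
    gateBits p side (List.replicate m x) = List.replicate m (side x) := by
  simpa using gateBits_eq_replicate (p := p) fun y hy => congrArg side (List.eq_of_mem_replicate hy)

theorem gateBits_eq_of_side_eq {w w' : List V} (hlen : w.length = w'.length)
    (h : ∀ x ∈ w, ∀ y ∈ w', side x = side y) : gateBits p side w = gateBits p side w' := by
  cases w with
  | nil => rw [List.eq_nil_of_length_eq_zero hlen.symm]
  | cons x w =>
    have hw' (y) (hy : y ∈ w') : side y = side x := (h x List.mem_cons_self y hy).symm
    obtain ⟨y, hy⟩ := List.exists_mem_of_length_pos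
      (hlen.symm ▸ Nat.succ_pos w.length : 0 < w'.length)
    rw [gateBits_eq_replicate hw', ← hlen]
    exact gateBits_eq_replicate fun z hz => (h z hz y hy).trans (hw' y hy)

theorem gateBits_ne_replicate {w : List V} {x z : V} {i : ℕ} (hx : p x) (hxz : side x ≠ side z)
    (hw : z :: List.replicate i x <:+ w) (m : ℕ) :
    gateBits p side w ≠ List.replicate m (side x) := by
  obtain ⟨w, rfl⟩ := hw
  intro h
  have hz : side z ∈ gateBits p side (w ++ z :: List.replicate i x) := by
    refine (gateBits_suffix_gateBits_append w _).mem ?_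
    simp [gateBits, hx]
  rw [h] at hz
  exact hxz (List.eq_of_mem_replicate hz).symm

theorem gateBits_ne_replicate_append (hside : ∀ x y, p x → p y → side x = side y → x = y)
    {w q : List V} {y : V} {b : Bool} {j : ℕ} (hj : j ≠ 0) (hq : (y :: q).all p) (hb : b ≠ side y)
    (hw : ¬ y :: q <:+ w) :
    gateBits p side w ≠ List.replicate j b ++ gateBits p side (y :: q) := by
  intro h
  have hlen : w.length = j + (y :: q).length := by simpa using congrArg List.length h
  obtain ⟨w₁, w₂, rfl, hw₁⟩ : ∃ w₁ w₂, w = w₁ ++ w₂ ∧ w₁.length = j :=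
    ⟨w.take j, w.drop j, (List.take_append_drop j w).symm, by simp [hlen]⟩
  have hsuffix : gateBits p side w₂ = gateBits p side (y :: q) := by
    obtain ⟨t, ht⟩ := gateBits_suffix_gateBits_append (p := p) (side := side) w₁ w₂
    refine (List.append_inj' (ht.trans h) ?_).2
    rw [List.length_append] at hlen
    simp only [length_gateBits]
    omega
  by_cases hw₂ : w₂.all p
  · refine hw ⟨w₁, congrArg (w₁ ++ ·) (Eq.symm ?_)⟩
    exact eq_of_gateBits_eq hside hw₂ hq hsuffix
  · rw [gateBits_append_of_not_all hw₂, hsuffix, hw₁, List.append_cancel_right_eq,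
      gateBits_of_all hq] at h
    exact hb (List.replicate_right_injective hj h).symm

end GateBits

section Suffix

variable {V : Type*}

theorem exists_eq_append (p : V → Bool) (w : List V) :
    ∃ q s, w = q ++ s ∧ q.all p ∧ ∀ z ∈ s.head?, ¬ p z := by
  refine ⟨_, _, List.takeWhile_append_dropWhile.symm, List.all_takeWhile, fun z hz => ?_⟩
  have := List.head?_dropWhile_not p w
  rw [Option.mem_def.1 hz] at this
  simpa using this

theorem dropWhile_append {p : V → Bool} {q s : List V} (hq : q.all p) (hs : ∀ z ∈ s.head?, ¬ p z) :
    (q ++ s).dropWhile p = s := by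
  rw [List.dropWhile_append_of_pos (List.all_eq_true.1 hq)]
  cases s with
  | nil => rfl
  | cons z s => exact List.dropWhile_cons_of_neg (hs z rfl)

theorem exists_eq_append_of_not_suffix {q s t : List V} (hts : t <:+ q ++ s) (h : ¬ t <:+ s) :
    ∃ q₁ q₂ z, q = q₁ ++ z :: q₂ ∧ t = z :: (q₂ ++ s) := by
  obtain ⟨r, rfl⟩ : s <:+ t :=
    (List.suffix_or_suffix_of_suffix hts (List.suffix_append q s)).resolve_left h
  obtain ⟨q₁, hq⟩ := hts
  rw [← List.append_assoc, List.append_cancel_right_eq] at hq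
  cases r with
  | nil => exact absurd List.suffix_rfl h
  | cons z q₂ => exact ⟨q₁, q₂, z, hq.symm, rfl⟩

theorem exists_eq_replicate_append {w : List V} (hw : w ≠ []) :
    ∃ x j r, w = List.replicate j x ++ r ∧ j ≠ 0 ∧ ∀ y ∈ r.head?, x ≠ y := by
  induction w with
  | nil => exact absurd rfl hw
  | cons x w ih =>
    by_cases hx : x ∈ w.head?
    · obtain ⟨w, rfl⟩ := List.head?_eq_some_iff.1 hx
      obtain ⟨y, j, r, h, hj, hr⟩ := ih (List.cons_ne_nil _ _)
      obtain ⟨j, rfl⟩ := Nat.exists_eq_succ_of_ne_zero hj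
      obtain rfl : x = y := (List.cons_eq_cons.1 h).1
      exact ⟨x, j + 2, r, congrArg (x :: ·) h, Nat.succ_ne_zero _, hr⟩
    · exact ⟨x, 1, w, rfl, one_ne_zero, fun y hy hxy => hx (hxy ▸ hy)⟩

theorem exists_cons_replicate_suffix {x : V} {w : List V} (hw : w ≠ List.replicate w.length x) :
    ∃ z i, x ≠ z ∧ z :: List.replicate i x <:+ w := by
  induction w with
  | nil => exact absurd rfl hw
  | cons z w ih =>
    by_cases h : w = List.replicate w.length x
    · refine ⟨z, w.length, fun hxz => hw ?_, h ▸ ?_⟩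
      · rw [List.length_cons, List.replicate_succ, ← h, hxz]
      · simp
    · obtain ⟨z', i, hz', hsuffix⟩ := ih h
      exact ⟨z', i, hz', hsuffix.trans (List.suffix_cons _ _)⟩

variable [DecidableEq V]

/-- The projection of words to the subgraph of the words with a given suffix, with that suffix
removed. A path that reaches a word with suffix `z :: s` from the outside does so at a word
`z ⋯ z z :: s`, which is therefore the image of every word without this suffix. -/
def suffixProj : List V → List V → List V
  | [], w => w
  | z :: s, w =>
    if z :: s <:+ w then w.take (w.length - (s.length + 1))
    else List.replicate (w.length - (s.length + 1)) z

theorem suffixProj_append (s w : List V) : suffixProj s (w ++ s) = w := by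
  cases s with
  | nil => exact List.append_nil w
  | cons z s => simp [suffixProj]

theorem suffixProj_of_not_suffix {z : V} {s w : List V} (h : ¬ z :: s <:+ w) :
    suffixProj (z :: s) w = List.replicate (w.length - (s.length + 1)) z := if_neg h

theorem length_suffixProj (s w : List V) : (suffixProj s w).length = w.length - s.length := by
  cases s with
  | nil => rfl
  | cons z s =>
    rw [suffixProj]
    split_ifs <;> simp

theorem gateBits_suffixProj_of_not_suffix {p side : V → Bool} {q s t : List V} {z : V}
    (hq : z ∈ q → ∀ x ∈ q, side x = side z) (h : ¬ z :: t <:+ s) :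
    gateBits p side (suffixProj (z :: t) (q ++ s)) =
      List.replicate ((q ++ s).length - (t.length + 1)) (side z) := by
  by_cases hts : z :: t <:+ q ++ s
  · obtain ⟨q₁, q₂, z, rfl, ht⟩ := exists_eq_append_of_not_suffix hts h
    obtain ⟨rfl, rfl⟩ := List.cons_eq_cons.1 ht
    rw [List.append_assoc, List.cons_append, suffixProj_append,
      gateBits_eq_replicate fun x hx => hq (by simp) x (List.mem_append_left _ hx)]
    congr 1
    simp
  · rw [suffixProj_of_not_suffix hts, gateBits_replicate]

end Suffix

section Sides

variable {V : Type*} {G : SimpleGraph V} {o : GraphOrientation G}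

open Classical in
/-- The side of an edge `a` of a tree on which a vertex lies: `true` if removing `a` disconnects
the vertex from the first endpoint of `a`. -/
noncomputable def farSide (G : SimpleGraph V) (a : V × V) (z : V) : Bool :=
  decide ¬ (G.deleteEdges {s(a.1, a.2)}).Reachable a.1 z

theorem farSide_eq_of_reachable {a : V × V} {x y : V}
    (h : (G.deleteEdges {s(a.1, a.2)}).Reachable x y) : farSide G a x = farSide G a y := by
  rw [farSide, farSide, decide_eq_decide, not_iff_not]
  exact ⟨fun hx => hx.trans h, fun hy => hy.trans h.symm⟩

theorem farSide_fst (a : V × V) : farSide G a a.1 = false := by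
  simp [farSide]

theorem farSide_snd (hG : G.IsAcyclic) {a : V × V} (ha : G.Adj a.1 a.2) :
    farSide G a a.2 = true := by
  have := SimpleGraph.isBridge_iff.1 (SimpleGraph.isAcyclic_iff_forall_adj_isBridge.1 hG ha)
  simpa only [farSide, decide_eq_true_eq] using this

theorem adj_of_arc (a : o.arcs) : G.Adj a.1.1 a.1.2 := o.adj_of_mem a.2

theorem mk_injective_arcs : Function.Injective fun a : o.arcs => s(a.1.1, a.1.2) := by
  rintro ⟨⟨x, y⟩, ha⟩ ⟨⟨x', y'⟩, hb⟩ h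
  rcases Sym2.eq_iff.1 h with ⟨rfl, rfl⟩ | ⟨rfl, rfl⟩
  · rfl
  · rcases o.mem_of_adj (o.adj_of_mem ha) with h | h
    exacts [absurd hb h.2, absurd ha h.2]

theorem exists_arc_mk_eq (o : GraphOrientation G) {x y : V} (h : G.Adj x y) :
    ∃ a : o.arcs, s(a.1.1, a.1.2) = s(x, y) := by
  rcases o.mem_of_adj h with h | h
  exacts [⟨⟨_, h.1⟩, rfl⟩, ⟨⟨_, h.1⟩, Sym2.eq_swap⟩]

noncomputable instance [Finite V] : Fintype o.arcs := Fintype.ofFinite _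

variable [DecidableEq V]

/-- Whether a letter is an endpoint of an edge, that is, whether it is moved by the corresponding
state of the automaton. -/
def onArc (a : V × V) (z : V) : Bool := decide (z = a.1 ∨ z = a.2)

theorem onArc_iff {a : V × V} {z : V} : onArc a z ↔ z = a.1 ∨ z = a.2 := decide_eq_true_iff

theorem onArc_iff_mem {a : V × V} {z : V} : onArc a z ↔ z ∈ s(a.1, a.2) := by
  rw [onArc_iff, Sym2.mem_iff]

theorem eq_of_farSide_eq (hG : G.IsAcyclic) {a : V × V} (ha : G.Adj a.1 a.2) (x y : V)
    (hx : onArc a x) (hy : onArc a y) (h : farSide G a x = farSide G a y) : x = y := by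
  have hfst := farSide_fst (G := G) a
  have hsnd := farSide_snd hG ha
  rcases onArc_iff.1 hx with rfl | rfl <;> rcases onArc_iff.1 hy with rfl | rfl <;> simp_all

theorem farSide_eq_of_onArc_of_ne {a b : o.arcs} (hab : a ≠ b) {x y : V}
    (hx : onArc b.1 x) (hy : onArc b.1 y) : farSide G a.1 x = farSide G a.1 y := by
  have h : farSide G a.1 b.1.1 = farSide G a.1 b.1.2 :=
    farSide_eq_of_reachable (SimpleGraph.Adj.reachable <| SimpleGraph.deleteEdges_adj.2
      ⟨adj_of_arc b, fun h => hab (mk_injective_arcs h).symm⟩)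
  rcases onArc_iff.1 hx with rfl | rfl <;> rcases onArc_iff.1 hy with rfl | rfl <;> simp [h]

theorem exists_onArc_farSide_ne (hG : G.IsTree) (o : GraphOrientation G) {x z : V} (hxz : x ≠ z) :
    ∃ a : o.arcs, onArc a.1 x ∧ farSide G a.1 x ≠ farSide G a.1 z := by
  obtain ⟨p, hp⟩ := (hG.1.preconnected x z).exists_isPath
  cases p with
  | nil => exact absurd rfl hxz
  | @cons _ y _ hxy q =>
    rw [SimpleGraph.Walk.cons_isPath_iff] at hp
    obtain ⟨a, ha⟩ := exists_arc_mk_eq o hxy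
    have hyz : farSide G a.1 y = farSide G a.1 z := by
      refine farSide_eq_of_reachable ?_
      rw [ha]
      exact ⟨q.toDeleteEdge s(x, y) fun h => hp.2 (q.fst_mem_support_of_mem_edges h)⟩
    have hx : onArc a.1 x := by simp [onArc_iff_mem, ha]
    have hy : onArc a.1 y := by simp [onArc_iff_mem, ha]
    refine ⟨a, hx, fun h => hxy.ne ?_⟩
    exact eq_of_farSide_eq hG.2 (adj_of_arc a) x y hx hy (h.trans hyz.symm)

end Sides

section Action

theorem act_injective {Q X : Type*} (A : Transducer Q X)
    (h : ∀ q, Function.Injective (A.output q)) (q : Q) : Function.Injective (A.act q) := by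
  intro w w' hw
  induction w generalizing q w' with
  | nil =>
    cases w' with
    | nil => rfl
    | cons => exact absurd hw (by simp [Transducer.act])
  | cons x w ih =>
    cases w' with
    | nil => exact absurd hw (by simp [Transducer.act])
    | cons x' w' =>
      rw [Transducer.act, Transducer.act, List.cons.injEq] at hw
      obtain rfl := h q hw.1
      rw [ih _ hw.2]

variable {V : Type*} [DecidableEq V] {G : SimpleGraph V} {o : GraphOrientation G}

theorem act_none (w : List V) : (graphAutomaton o).act none w = w := by
  induction w with
  | nil => rfl
  | cons z w ih => exact congrArg (z :: ·) ih

theorem output_injective (q : Option o.arcs) :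
    Function.Injective ((graphAutomaton o).output q) := by
  cases q with
  | none => exact Function.injective_id
  | some e => exact (Equiv.swap e.1.1 e.1.2).injective

variable (e : o.arcs)

theorem act_fst_cons (w : List V) : (graphAutomaton o).act (some e) (e.1.1 :: w) =
    e.1.2 :: (graphAutomaton o).act (some e) w := by
  simp [Transducer.act, graphAutomaton]

theorem act_snd_cons (w : List V) :
    (graphAutomaton o).act (some e) (e.1.2 :: w) = e.1.1 :: w := by
  have hne := (adj_of_arc e).ne'
  have := act_none (o := o) w
  simp_all [Transducer.act, graphAutomaton]

variable {e}

theorem act_eq_self {w : List V} (hw : ∀ z ∈ w.head?, ¬ onArc e.1 z) :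
    (graphAutomaton o).act (some e) w = w := by
  cases w with
  | nil => rfl
  | cons z w =>
    have hz : ¬ (z = e.1.1 ∨ z = e.1.2) := fun h => hw z rfl (onArc_iff.2 h)
    have := act_none (o := o) w
    simp_all [Transducer.act, graphAutomaton]

theorem act_append {q s : List V} (hq : q.all (onArc e.1)) (hs : ∀ z ∈ s.head?, ¬ onArc e.1 z) :
    (graphAutomaton o).act (some e) (q ++ s) = (graphAutomaton o).act (some e) q ++ s := by
  induction q with
  | nil => exact act_eq_self hs
  | cons x q ih =>
    rw [List.all_cons, Bool.and_eq_true, onArc_iff] at hq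
    rcases hq.1 with rfl | rfl
    · rw [List.cons_append, act_fst_cons, act_fst_cons, ih hq.2, List.cons_append]
    · rw [List.cons_append, act_snd_cons, act_snd_cons, List.cons_append]

theorem all_onArc_act {q : List V} (hq : q.all (onArc e.1)) :
    ((graphAutomaton o).act (some e) q).all (onArc e.1) := by
  induction q with
  | nil => rfl
  | cons x q ih =>
    rw [List.all_cons, Bool.and_eq_true, onArc_iff] at hq
    rcases hq.1 with rfl | rfl
    · simp [act_fst_cons, ih hq.2, onArc]
    · simp [act_snd_cons, hq.2, onArc]

theorem dropWhile_act (w : List V) : ((graphAutomaton o).act (some e) w).dropWhile (onArc e.1) =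
    w.dropWhile (onArc e.1) := by
  obtain ⟨q, s, rfl, hq, hs⟩ := exists_eq_append (onArc e.1) w
  rw [act_append hq hs, dropWhile_append hq hs, dropWhile_append (all_onArc_act hq) hs]

theorem exists_ofBits_act {side : V → Bool} (hfst : side e.1.1 = false) (hsnd : side e.1.2 = true)
    (n : ℕ) {q : List V} (hq : q.all (onArc e.1)) :
    ∃ t, ofBits n (((graphAutomaton o).act (some e) q).map side) =
      ofBits n (q.map side) - 1 + 2 ^ q.length * t := by
  induction q with
  | nil => exact ⟨1, by simp [Transducer.act]⟩
  | cons x q ih =>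
    rw [List.all_cons, Bool.and_eq_true, onArc_iff] at hq
    rcases hq.1 with rfl | rfl
    · obtain ⟨t, ht⟩ := ih hq.2
      refine ⟨t, ?_⟩
      rw [act_fst_cons, List.map_cons, List.map_cons, ofBits_cons, ofBits_cons, ht, hfst, hsnd,
        List.length_cons, pow_succ, Bool.toNat_true, Bool.toNat_false]
      push_cast
      ring
    · refine ⟨0, ?_⟩
      rw [act_snd_cons, List.map_cons, List.map_cons, ofBits_cons, ofBits_cons, hfst, hsnd,
        Bool.toNat_true, Bool.toNat_false]
      push_cast
      ring

theorem ofBits_act {side : V → Bool} (hfst : side e.1.1 = false) (hsnd : side e.1.2 = true)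
    {n : ℕ} {q : List V} (hn : q.length = n) (hq : q.all (onArc e.1)) :
    ofBits n (((graphAutomaton o).act (some e) q).map side) = ofBits n (q.map side) - 1 := by
  obtain ⟨t, ht⟩ := exists_ofBits_act hfst hsnd n hq
  rw [ht, hn, two_pow_eq_zero, zero_mul, add_zero]

end Action

section Cycles

variable {V : Type*} [DecidableEq V] {G : SimpleGraph V}

/-- An index of a cycle of the `n`-th Schreier graph: an edge `a` together with a word `s` whose
first letter is not an endpoint of `a`. The cycle, an orbit of the state `a`, consists of the
words of length `n` that are the concatenation of a word in the endpoints of `a` with `s`. -/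
@[ext]
structure SchreierCycle (o : GraphOrientation G) (n : ℕ) where
  /-- the edge whose state permutes the cycle -/
  arc : o.arcs
  /-- the common suffix of the words on the cycle -/
  suffix : List V
  length_lt : suffix.length < n
  not_onArc : ∀ z ∈ suffix.head?, ¬ onArc arc.1 z

namespace SchreierCycle

variable {o : GraphOrientation G} {n : ℕ}

/-- Cycles sorted by their edge and by the length of their suffix. -/
def equivSigma : SchreierCycle o n ≃ Σ (a : o.arcs) (l : Fin n),
    {s : List.Vector V l // ∀ z ∈ s.toList.head?, ¬ onArc a.1 z} where
  toFun c := ⟨c.arc, ⟨_, c.length_lt⟩, ⟨c.suffix, rfl⟩, c.not_onArc⟩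
  invFun x := ⟨x.1, x.2.2.1.toList, by simp, x.2.2.2⟩
  left_inv _ := rfl
  right_inv := by
    rintro ⟨a, ⟨l, hl⟩, ⟨s, h⟩, hs⟩
    obtain rfl : s.length = l := h
    rfl

noncomputable instance [Fintype V] : Fintype (SchreierCycle o n) :=
  Fintype.ofEquiv _ equivSigma.symm

variable (c : SchreierCycle o n)

/-- The position on a cycle of the vertex of the cycle that is closest to a given word. -/
noncomputable def position (w : List V) : ZMod (2 ^ (n - c.suffix.length)) :=
  ofBits _ (gateBits (onArc c.arc.1) (farSide G c.arc.1) (suffixProj c.suffix w))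

variable {c}

theorem gateBits_eq_of_position_eq {w w' : List V} (hw : w.length = n) (hw' : w'.length = n)
    (h : c.position w = c.position w') :
    gateBits (onArc c.arc.1) (farSide G c.arc.1) (suffixProj c.suffix w) =
      gateBits (onArc c.arc.1) (farSide G c.arc.1) (suffixProj c.suffix w') :=
  eq_of_ofBits_eq (by rw [length_gateBits, length_suffixProj, hw])
    (by rw [length_gateBits, length_suffixProj, hw']) h

theorem position_act (hG : G.IsAcyclic) {w : List V} (hw : w.length = n)
    (h : w.dropWhile (onArc c.arc.1) = c.suffix) :
    c.position ((graphAutomaton o).act (some c.arc) w) = c.position w - 1 := by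
  obtain ⟨q, s, rfl, hq, hs⟩ := exists_eq_append (onArc c.arc.1) w
  rw [dropWhile_append hq hs] at h
  subst h
  rw [position, position, act_append hq hs, suffixProj_append, suffixProj_append,
    gateBits_of_all hq, gateBits_of_all (all_onArc_act hq)]
  rw [List.length_append] at hw
  exact ofBits_act (farSide_fst _) (farSide_snd hG (adj_of_arc _)) (by omega) hq

theorem position_append_congr {e : o.arcs} {q q' s : List V} (hq : q.all (onArc e.1))
    (hq' : q'.all (onArc e.1)) (hlen : q.length = q'.length)
    (hs : ∀ z ∈ s.head?, ¬ onArc e.1 z) (hc : ¬ (c.arc = e ∧ c.suffix = s)) :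
    c.position (q ++ s) = c.position (q' ++ s) := by
  rw [List.all_eq_true] at hq hq'
  refine congrArg (ofBits _) ?_
  by_cases hts : c.suffix <:+ s
  · obtain ⟨r, hr⟩ := hts
    rw [← hr, ← List.append_assoc, ← List.append_assoc, suffixProj_append, suffixProj_append]
    by_cases hrc : r.all (onArc c.arc.1)
    · have hne : c.arc ≠ e := by
        rintro rfl
        cases r with
        | nil => exact hc ⟨rfl, hr⟩
        | cons z r => exact hs z (by simp [← hr]) (List.all_eq_true.1 hrc z (by simp))
      rw [gateBits_append_of_all hrc, gateBits_append_of_all hrc, gateBits_eq_of_side_eq hlen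
        fun x hx y hy => farSide_eq_of_onArc_of_ne hne (hq x hx) (hq' y hy)]
    · rw [gateBits_append_of_not_all hrc, gateBits_append_of_not_all hrc, hlen]
  · obtain ⟨z, t, ht⟩ := List.exists_cons_of_ne_nil fun h : c.suffix = [] =>
      hts (h ▸ List.nil_suffix)
    have side_eq {q : List V} (hq : ∀ x ∈ q, onArc e.1 x) (hz : z ∈ q) :
        ∀ x ∈ q, farSide G c.arc.1 x = farSide G c.arc.1 z := by
      intro x hx
      refine farSide_eq_of_onArc_of_ne (fun h => ?_) (hq x hx) (hq z hz)
      exact c.not_onArc z (by simp [ht]) (h ▸ hq z hz)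
    rw [ht] at hts ⊢
    rw [gateBits_suffixProj_of_not_suffix (side_eq hq) hts,
      gateBits_suffixProj_of_not_suffix (side_eq hq') hts]
    simp only [List.length_append, hlen]

theorem position_act_of_ne {e : o.arcs} {w : List V}
    (hc : ¬ (c.arc = e ∧ c.suffix = w.dropWhile (onArc e.1))) :
    c.position ((graphAutomaton o).act (some e) w) = c.position w := by
  obtain ⟨q, s, rfl, hq, hs⟩ := exists_eq_append (onArc e.1) w
  rw [dropWhile_append hq hs] at hc
  rw [act_append hq hs]
  exact position_append_congr (all_onArc_act hq) hq (Transducer.length_act _ _ _) hs hc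

end SchreierCycle

open SchreierCycle

variable {o : GraphOrientation G} {n : ℕ}

theorem exists_position_act (hG : G.IsAcyclic) {e : o.arcs} {w : List V} (hw : w.length = n)
    (hne : (graphAutomaton o).act (some e) w ≠ w) : ∃ c : SchreierCycle o n,
      c.position ((graphAutomaton o).act (some e) w) = c.position w - 1 ∧
      ∀ c' ≠ c, c'.position ((graphAutomaton o).act (some e) w) = c'.position w := by
  obtain ⟨q, s, rfl, hq, hs⟩ := exists_eq_append (onArc e.1) w
  have hlt : s.length < n := by
    rw [List.length_append] at hw
    have : q ≠ [] := by
      rintro rfl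
      exact hne (act_eq_self hs)
    have := List.length_pos_iff.2 this
    omega
  refine ⟨⟨e, s, hlt, hs⟩, position_act hG hw (dropWhile_append hq hs), fun c' hc' => ?_⟩
  refine position_act_of_ne fun h => hc' ?_
  rw [dropWhile_append hq hs] at h
  exact SchreierCycle.ext h.1 h.2

theorem exists_cycle_of_onArc {a : o.arcs} {x : V} {j : ℕ} {r : List V} (hx : onArc a.1 x)
    (hj : j ≠ 0) (hn : j + r.length = n) : ∃ (c : SchreierCycle o n) (q : List V), c.arc = a ∧
      r = q ++ c.suffix ∧ q.all (onArc a.1) ∧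
      (List.replicate j x ++ r).dropWhile (onArc a.1) = c.suffix := by
  obtain ⟨q, s, rfl, hq, hs⟩ := exists_eq_append (onArc a.1) r
  rw [List.length_append] at hn
  refine ⟨⟨a, s, by omega, hs⟩, q, rfl, rfl, hq, ?_⟩
  rw [← List.append_assoc, dropWhile_append _ hs]
  simp [hq, hx]

theorem exists_position_ne_of_ne_replicate (hG : G.IsTree) {x : V} {j : ℕ} {v r : List V}
    (hj : j ≠ 0) (hv : v.length = j) (hn : j + r.length = n) (hne : v ≠ List.replicate j x) :
    ∃ c : SchreierCycle o n, (List.replicate j x ++ r).dropWhile (onArc c.arc.1) = c.suffix ∧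
      c.position (List.replicate j x ++ r) ≠ c.position (v ++ r) := by
  obtain ⟨z, i, hxz, hsuffix⟩ := exists_cons_replicate_suffix (hv.symm ▸ hne)
  obtain ⟨a, hx, hside⟩ := exists_onArc_farSide_ne hG o hxz
  obtain ⟨c, q, rfl, rfl, hq, hdrop⟩ := exists_cycle_of_onArc hx hj hn
  refine ⟨c, hdrop, fun h => gateBits_ne_replicate hx hside hsuffix j ?_⟩
  have := gateBits_eq_of_position_eq (by simpa using hn) (by simpa [hv] using hn) h
  rw [← List.append_assoc, ← List.append_assoc, suffixProj_append, suffixProj_append,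
    gateBits_append_of_all hq, gateBits_append_of_all hq, List.append_cancel_right_eq,
    gateBits_replicate] at this
  exact this.symm

theorem exists_position_ne_of_not_suffix (hG : G.IsTree) {x y : V} {j : ℕ} {v r : List V}
    (hj : j ≠ 0) (hxy : x ≠ y) (hv : v.length = n) (hn : j + (y :: r).length = n)
    (hsuffix : ¬ y :: r <:+ v) : ∃ c : SchreierCycle o n,
      (List.replicate j x ++ y :: r).dropWhile (onArc c.arc.1) = c.suffix ∧
      c.position (List.replicate j x ++ y :: r) ≠ c.position v := by
  obtain ⟨a, hx, hside⟩ := exists_onArc_farSide_ne hG o hxy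
  obtain ⟨c, q, rfl, hr, hq, hdrop⟩ := exists_cycle_of_onArc hx hj hn
  refine ⟨c, hdrop, fun h => ?_⟩
  have hbits := gateBits_eq_of_position_eq (by simpa using hn) hv h
  rw [hr, ← List.append_assoc, suffixProj_append, gateBits_append_of_all hq,
    gateBits_replicate] at hbits
  by_cases hs : c.suffix <:+ v
  · obtain ⟨w, rfl⟩ := hs
    rw [suffixProj_append] at hbits
    cases q with
    | nil => exact hsuffix (hr ▸ List.suffix_append _ _)
    | cons y' q =>
      obtain rfl : y = y' := (List.cons_eq_cons.1 hr).1
      refine gateBits_ne_replicate_append (eq_of_farSide_eq hG.2 (adj_of_arc c.arc)) hj hq hside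
        (fun h => hsuffix ?_) hbits.symm
      rw [hr]
      exact List.suffix_append_self_iff.2 h
  · obtain ⟨z, t, hzt⟩ := List.exists_cons_of_ne_nil fun h : c.suffix = [] =>
      hs (h ▸ List.nil_suffix)
    rw [hzt] at hs hr hbits
    rw [suffixProj_of_not_suffix hs, gateBits_replicate] at hbits
    have eq_side_z {b : Bool} (hb : b ∈ List.replicate j (farSide G c.arc.1 x) ++
        gateBits (onArc c.arc.1) (farSide G c.arc.1) q) : b = farSide G c.arc.1 z := by
      rw [hbits] at hb
      exact List.eq_of_mem_replicate hb
    refine hside ((eq_side_z ?_).trans ?_)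
    · simp [hj]
    · cases q with
      | nil => rw [(List.cons_eq_cons.1 hr).1]
      | cons y' q =>
        obtain rfl : y = y' := (List.cons_eq_cons.1 hr).1
        exact (eq_side_z (by simp [gateBits_of_all hq])).symm

theorem exists_position_ne (hG : G.IsTree) {u v : List V} (hu : u.length = n) (hv : v.length = n)
    (huv : u ≠ v) : ∃ c : SchreierCycle o n,
      u.dropWhile (onArc c.arc.1) = c.suffix ∧ c.position u ≠ c.position v := by
  have hne : u ≠ [] := by
    rintro rfl
    exact huv (List.eq_nil_of_length_eq_zero (hv.trans hu.symm)).symm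
  obtain ⟨x, j, r, rfl, hj, hr⟩ := exists_eq_replicate_append hne
  rw [List.length_append, List.length_replicate] at hu
  by_cases hrv : r <:+ v
  · obtain ⟨v, rfl⟩ := hrv
    rw [List.length_append] at hv
    exact exists_position_ne_of_ne_replicate hG hj (by omega) hu fun h => huv (h ▸ rfl)
  · obtain ⟨y, r, rfl⟩ := List.exists_cons_of_ne_nil fun h : r = [] => hrv (h ▸ List.nil_suffix)
    exact exists_position_ne_of_not_suffix hG hj (hr y rfl) hv hu hrv

theorem simpleSchreierGraph_adj {u v : List.Vector V n} :
    ((graphAutomaton o).simpleSchreierGraph n).Adj u v ↔ u ≠ v ∧ ∃ e : o.arcs,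
      v = (graphAutomaton o).actWord n (some e) u ∨
        u = (graphAutomaton o).actWord n (some e) v := by
  rw [Transducer.simpleSchreierGraph, SimpleGraph.fromRel_adj]
  refine and_congr_right fun huv => ?_
  have actWord_none (w : List.Vector V n) : (graphAutomaton o).actWord n none w = w :=
    Subtype.ext (act_none _)
  constructor
  · rintro (⟨⟨q, w⟩, h⟩ | ⟨⟨q, w⟩, h⟩) <;> cases q with
    | none =>
      simp only [Transducer.schreierGraph, actWord_none] at h
      exact absurd (by rcases h with ⟨rfl, rfl⟩ | ⟨rfl, rfl⟩ <;> rfl) huv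
    | some e =>
      simp only [Transducer.schreierGraph] at h
      exact ⟨e, by rcases h with ⟨rfl, h⟩ | ⟨rfl, h⟩ <;> simp [h]⟩
  · rintro ⟨e, h | h⟩
    · exact Or.inl ⟨(some e, u), Or.inl ⟨rfl, h⟩⟩
    · exact Or.inl ⟨(some e, v), Or.inr ⟨rfl, h⟩⟩

theorem exists_actWord_eq [Finite V] (e : o.arcs) (v : List.Vector V n) :
    ∃ u, (graphAutomaton o).actWord n (some e) u = v := by
  have := Fintype.ofFinite V
  have hinj : Function.Injective ((graphAutomaton o).actWord n (some e)) := fun u u' h =>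
    Subtype.ext (act_injective _ output_injective _ (congrArg Subtype.val h))
  exact Finite.injective_iff_surjective.1 hinj v

theorem simpleSchreierGraph_adj_of_position_ne {c : SchreierCycle o n} {u v : List.Vector V n}
    (h : v = (graphAutomaton o).actWord n (some c.arc) u ∨
      u = (graphAutomaton o).actWord n (some c.arc) v)
    (hne : c.position u.toList ≠ c.position v.toList) :
    ((graphAutomaton o).simpleSchreierGraph n).Adj u v :=
  simpleSchreierGraph_adj.2 ⟨fun huv => hne (huv ▸ rfl), c.arc, h⟩

theorem simpleSchreierGraph_connected_and_dist_eq [Fintype V] (hG : G.IsTree)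
    (o : GraphOrientation G) (n : ℕ) : ((graphAutomaton o).simpleSchreierGraph n).Connected ∧
      ∀ u v, ((graphAutomaton o).simpleSchreierGraph n).dist u v =
        ∑ c : SchreierCycle o n, cycleDist (c.position u.toList) (c.position v.toList) := by
  have : Nonempty (List.Vector V n) := ⟨List.Vector.replicate n hG.1.nonempty.some⟩
  refine connected_and_dist_eq_sum_cycleDist _
    (fun (w : List.Vector V n) (c : SchreierCycle o n) => c.position w.toList) ?_ ?_
  · intro u v huv
    obtain ⟨hne, e, rfl | rfl⟩ := simpleSchreierGraph_adj.1 huv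
    · obtain ⟨c, hc, hc'⟩ := exists_position_act hG.2 u.2 fun h => hne (Subtype.ext h.symm)
      exact ⟨c, Or.inr hc, hc'⟩
    · obtain ⟨c, hc, hc'⟩ := exists_position_act hG.2 v.2 fun h => hne (Subtype.ext h)
      exact ⟨c, Or.inl (eq_add_of_sub_eq hc.symm), fun c' h => (hc' c' h).symm⟩
  · intro u v huv
    obtain ⟨c, hc, hne⟩ := exists_position_ne (o := o) hG u.2 v.2 fun h => huv (Subtype.ext h)
    obtain ⟨w, hw⟩ := exists_actWord_eq c.arc u
    have hu : (graphAutomaton o).act (some c.arc) w.toList = u.toList := congrArg Subtype.val hw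
    have : Fact (1 < 2 ^ (n - c.suffix.length)) :=
      ⟨Nat.one_lt_two_pow (Nat.sub_ne_zero_of_lt c.length_lt)⟩
    set u' := (graphAutomaton o).actWord n (some c.arc) u
    have hsucc : c.position u'.toList = c.position u.toList - 1 := position_act hG.2 u.2 hc
    have hpred : c.position w.toList = c.position u.toList + 1 := by
      rw [← hu, position_act hG.2 w.toList_length (by rw [← dropWhile_act, hu]; exact hc),
        sub_add_cancel]
    refine ⟨c, hne, ⟨w, simpleSchreierGraph_adj_of_position_ne (c := c) (Or.inr hw.symm) ?_, hpred⟩,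
      u', simpleSchreierGraph_adj_of_position_ne (c := c) (Or.inl rfl) ?_, hsucc⟩
    · simp [hpred]
    · rw [hsucc, ne_comm]
      simp

end Cycles

section TreeDistance

variable {V : Type*} [Finite V] {G : SimpleGraph V}

theorem dist_eq_sum_cycleDist_farSide (hG : G.IsTree) (o : GraphOrientation G) (u v : V) :
    G.dist u v =
      ∑ a : o.arcs, cycleDist (N := 2) (farSide G a.1 u).toNat (farSide G a.1 v).toNat := by
  classical
  have cast_toNat_of_ne {a : o.arcs} {x y : V} (h : farSide G a.1 x ≠ farSide G a.1 y) :
      ((farSide G a.1 y).toNat : ZMod 2) = (farSide G a.1 x).toNat + 1 ∧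
        ((farSide G a.1 y).toNat : ZMod 2) = (farSide G a.1 x).toNat - 1 := by
    revert h
    generalize farSide G a.1 x = b
    generalize farSide G a.1 y = b'
    revert b b'
    decide
  have := hG.1.nonempty
  refine (connected_and_dist_eq_sum_cycleDist G (N := fun _ => 2)
    (fun v (a : o.arcs) => (farSide G a.1 v).toNat) ?_ ?_).2 u v
  · intro x y hxy
    obtain ⟨a, ha⟩ := exists_arc_mk_eq o hxy
    have hx : onArc a.1 x := by simp [onArc_iff_mem, ha]
    have hy : onArc a.1 y := by simp [onArc_iff_mem, ha]
    have hne : farSide G a.1 x ≠ farSide G a.1 y := fun h =>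
      hxy.ne (eq_of_farSide_eq hG.2 (adj_of_arc a) x y hx hy h)
    exact ⟨a, Or.inl (cast_toNat_of_ne hne).1, fun b hb => by
      rw [farSide_eq_of_onArc_of_ne hb hy hx]⟩
  · intro x z hxz
    obtain ⟨a, hx, hne⟩ := exists_onArc_farSide_ne hG o hxz
    obtain ⟨y, hxy, hside⟩ : ∃ y, G.Adj x y ∧ farSide G a.1 x ≠ farSide G a.1 y := by
      rcases onArc_iff.1 hx with rfl | rfl
      · exact ⟨_, adj_of_arc a, by simp [farSide_fst, farSide_snd hG.2 (adj_of_arc a)]⟩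
      · exact ⟨_, (adj_of_arc a).symm, by simp [farSide_fst, farSide_snd hG.2 (adj_of_arc a)]⟩
    obtain ⟨hadd, hsub⟩ := cast_toNat_of_ne hside
    refine ⟨a, fun h => ?_, ⟨y, hxy, hadd⟩, y, hxy, hsub⟩
    simpa [h] using (cast_toNat_of_ne hne).1

end TreeDistance

section SideCard

variable {V : Type*} [Fintype V]

/-- The number of letters on a given side of a partition of the alphabet into two sides, as a
rational number. -/
def sideCard (side : V → Bool) (b : Bool) : ℚ := (Finset.univ.filter fun z => side z = b).card

theorem sum_comp_side (side : V → Bool) (g : Bool → ℚ) :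
    ∑ z, g (side z) = sideCard side false * g false + sideCard side true * g true := by
  rw [← Finset.sum_fiberwise Finset.univ side, Fintype.sum_bool, add_comm]
  congr 1 <;>
  · rw [Finset.sum_congr rfl fun z hz => by rw [(Finset.mem_filter.1 hz).2], Finset.sum_const,
      nsmul_eq_mul, sideCard]

theorem sideCard_add (side : V → Bool) :
    sideCard side false + sideCard side true = Fintype.card V := by
  simpa using (sum_comp_side side 1).symm

theorem sum_onArc_add [DecidableEq V] {a : V × V} (ha : a.1 ≠ a.2) (f : V → ℚ) :
    f a.1 + f a.2 + ∑ z with ¬ onArc a z, f z = ∑ z, f z := by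
  rw [← Finset.sum_filter_add_sum_filter_not Finset.univ (fun z => onArc a z), ← Finset.sum_pair ha]
  congr 2
  ext z
  simp [onArc]

theorem sum_not_onArc_comp_side [DecidableEq V] {a : V × V} {side : V → Bool}
    (hfst : side a.1 = false) (hsnd : side a.2 = true) (g : Bool → ℚ) :
    ∑ z with ¬ onArc a z, g (side z) =
      (sideCard side false - 1) * g false + (sideCard side true - 1) * g true := by
  have ha : a.1 ≠ a.2 := fun h => by simp [h, hsnd] at hfst
  have := sum_onArc_add ha fun z => g (side z)
  rw [sum_comp_side, hfst, hsnd] at this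
  linear_combination this

variable {G : SimpleGraph V}

theorem card_arcs_add_one (hG : G.IsTree) (o : GraphOrientation G) :
    Fintype.card o.arcs + 1 = Fintype.card V := by
  classical
  have mem_edgeSet (a : o.arcs) : s(a.1.1, a.1.2) ∈ G.edgeSet := adj_of_arc a
  have hbij : Function.Bijective fun a : o.arcs => (⟨_, mem_edgeSet a⟩ : G.edgeSet) := by
    refine ⟨fun a b h => mk_injective_arcs (congrArg Subtype.val h), ?_⟩
    rintro ⟨⟨x, y⟩, h⟩
    exact (exists_arc_mk_eq o h).imp fun a ha => Subtype.ext ha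
  rw [← hG.card_edgeFinset, Fintype.card_of_bijective hbij, SimpleGraph.edgeFinset_card]

theorem wienerIndex_eq_sum_sideCard (hG : G.IsTree) (o : GraphOrientation G) :
    wienerIndex G =
      ∑ a : o.arcs, sideCard (farSide G a.1) false * sideCard (farSide G a.1) true := by
  have sum_cycleDist (a : o.arcs) :
      ∑ u, ∑ v, (cycleDist (N := 2) (farSide G a.1 u).toNat (farSide G a.1 v).toNat : ℚ) =
        2 * (sideCard (farSide G a.1) false * sideCard (farSide G a.1) true) := by
    have h01 : cycleDist (N := 2) 0 1 = 1 := by decide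
    refine (sum_comp_side (farSide G a.1) fun b =>
      ∑ v, (cycleDist (N := 2) b.toNat (farSide G a.1 v).toNat : ℚ)).trans ?_
    rw [sum_comp_side (farSide G a.1) fun b => (cycleDist (N := 2) false.toNat b.toNat : ℚ),
      sum_comp_side (farSide G a.1) fun b => (cycleDist (N := 2) true.toNat b.toNat : ℚ)]
    simp only [cycleDist_self, Bool.toNat_false, Bool.toNat_true, Nat.cast_zero, Nat.cast_one, h01,
      cycleDist_comm 1 0]
    ring
  simp only [wienerIndex, dist_eq_sum_cycleDist_farSide hG o, Nat.cast_sum]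
  simp only [fun u => Finset.sum_comm (s := Finset.univ (α := V)) (t := Finset.univ (α := o.arcs))
    (f := fun v a => (cycleDist (N := 2) (farSide G a.1 u).toNat (farSide G a.1 v).toNat : ℚ))]
  rw [Finset.sum_comm, Finset.sum_congr rfl fun a _ => sum_cycleDist a, ← Finset.mul_sum]
  ring

theorem sum_sideCard_sub_one (hG : G.IsTree) (o : GraphOrientation G) :
    ∑ a : o.arcs, (sideCard (farSide G a.1) false - 1) * (sideCard (farSide G a.1) true - 1) =
      wienerIndex G - ((Fintype.card V : ℚ) - 1) ^ 2 := by
  have hcard : (Fintype.card o.arcs : ℚ) = Fintype.card V - 1 := by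
    rw [← card_arcs_add_one hG o, Nat.cast_succ, add_sub_cancel_right]
  calc
    _ = ∑ a : o.arcs, (sideCard (farSide G a.1) false * sideCard (farSide G a.1) true -
        ((Fintype.card V : ℚ) - 1)) := Finset.sum_congr rfl fun a _ => by
      rw [← sideCard_add (farSide G a.1)]
      ring
    _ = _ := by
      rw [Finset.sum_sub_distrib, ← wienerIndex_eq_sum_sideCard hG, Finset.sum_const,
        Finset.card_univ, nsmul_eq_mul, hcard, pow_two]

end SideCard

section WordSum

variable {V : Type*} [Fintype V]

/-- The sum of a function over all words of length `n`. -/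
def wordSum (n : ℕ) (f : List V → ℚ) : ℚ := ∑ w : List.Vector V n, f w.toList

theorem wordSum_congr {n : ℕ} {f g : List V → ℚ} (h : ∀ w, w.length = n → f w = g w) :
    wordSum n f = wordSum n g :=
  Finset.sum_congr rfl fun w _ => h _ w.toList_length

theorem wordSum_add (n : ℕ) (f g : List V → ℚ) :
    wordSum n (fun w => f w + g w) = wordSum n f + wordSum n g := Finset.sum_add_distrib

theorem wordSum_comm (m n : ℕ) (f : List V → List V → ℚ) :
    wordSum m (fun u => wordSum n (f u)) = wordSum n fun v => wordSum m fun u => f u v :=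
  Finset.sum_comm

theorem wordSum_finsetSum {ι : Type*} (n : ℕ) (s : Finset ι) (f : ι → List V → ℚ) :
    wordSum n (fun w => ∑ i ∈ s, f i w) = ∑ i ∈ s, wordSum n (f i) := Finset.sum_comm

theorem wordSum_const_mul (n : ℕ) (c : ℚ) (f : List V → ℚ) :
    wordSum n (fun w => c * f w) = c * wordSum n f := (Finset.mul_sum _ _ _).symm

theorem wordSum_const (n : ℕ) (c : ℚ) :
    wordSum n (fun _ : List V => c) = (Fintype.card V : ℚ) ^ n * c := by
  simp [wordSum, card_vector]

theorem wordSum_ite_eq [DecidableEq V] (s : List V) (c : ℚ) :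
    wordSum s.length (fun w => if w = s then c else 0) = c := by
  obtain ⟨v, hv⟩ : ∃ v : List.Vector V s.length, v.toList = s := ⟨⟨s, rfl⟩, rfl⟩
  simp only [wordSum, ← hv]
  simp [List.Vector.toList_injective.eq_iff]

theorem wordSum_zero (f : List V → ℚ) : wordSum 0 f = f [] := by
  rw [wordSum, Fintype.sum_eq_single List.Vector.nil fun w hw => absurd w.eq_nil hw]
  rfl

theorem wordSum_succ (n : ℕ) (f : List V → ℚ) :
    wordSum (n + 1) f = ∑ z, wordSum n fun w => f (z :: w) := by
  simp only [wordSum]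
  rw [← Fintype.sum_prod_type']
  refine (Fintype.sum_equiv ⟨fun p => p.1 ::ᵥ p.2, fun w => (w.head, w.tail), fun p => by simp,
    fun w => by simp⟩ _ _ fun p => ?_).symm
  simp

theorem wordSum_add_length (m n : ℕ) (f : List V → ℚ) :
    wordSum (m + n) f = wordSum m fun u => wordSum n fun v => f (u ++ v) := by
  induction m generalizing f with
  | zero => simp [wordSum_zero]
  | succ m ih =>
    rw [Nat.succ_add, wordSum_succ, wordSum_succ]
    exact Finset.sum_congr rfl fun z _ => ih fun w => f (z :: w)

theorem wordSum_succ' (n : ℕ) (f : List V → ℚ) :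
    wordSum (n + 1) f = wordSum n fun w => ∑ z, f (w ++ [z]) := by
  rw [wordSum_add_length]
  refine wordSum_congr fun w _ => (wordSum_succ 0 _).trans ?_
  simp only [wordSum_zero]

theorem wordSum_suffixProj [DecidableEq V] (m : ℕ) (z : V) (t : List V) (f : List V → ℚ) :
    wordSum (m + (z :: t).length) (fun w => f (suffixProj (z :: t) w)) = wordSum m f +
      ((Fintype.card V : ℚ) ^ (m + (z :: t).length) - (Fintype.card V : ℚ) ^ m) *
        f (List.replicate m z) := by
  have comp_suffixProj {q r : List V} (hq : q.length = m) (hr : r.length = (z :: t).length) :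
      f (suffixProj (z :: t) (q ++ r)) =
        f (List.replicate m z) + if r = z :: t then f q - f (List.replicate m z) else 0 := by
    split_ifs with h
    · rw [h, suffixProj_append, add_sub_cancel]
    · have hsuffix : ¬ z :: t <:+ q ++ r := fun h' => h
        ((List.suffix_of_suffix_length_le h' (List.suffix_append q r) hr.ge).eq_of_length
          hr.symm).symm
      rw [suffixProj_of_not_suffix hsuffix, List.length_append, hq, hr, List.length_cons,
        Nat.add_sub_cancel, add_zero]
  rw [wordSum_add_length, wordSum_congr fun q hq => wordSum_congr fun r hr => comp_suffixProj hq hr]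
  simp only [wordSum_add, wordSum_const, wordSum_ite_eq, sub_eq_add_neg]
  ring

end WordSum

section GateDist

variable {V : Type*} {p side : V → Bool} {m : ℕ}

/-- The distance of the projections of two words of length `m` to the large cycle, of length
`2 ^ m`, of an edge that is given by its endpoints `p` and its two sides `side`. -/
def gateDist (p side : V → Bool) (m : ℕ) (u v : List V) : ℕ :=
  cycleDist (ofBits m (gateBits p side u)) (ofBits m (gateBits p side v))

theorem gateDist_self (u : List V) : gateDist p side m u u = 0 := cycleDist_self _

theorem gateDist_comm (u v : List V) : gateDist p side m u v = gateDist p side m v u :=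
  cycleDist_comm _ _

theorem cycleDist_ofBits_append_add {w : List V} (hw : w.length = m) (d : ZMod (2 ^ (m + 1)))
    {x y : V} (hx : p x) (hy : p y) (hsx : side x = false) (hsy : side y = true) :
    cycleDist (ofBits (m + 1) (gateBits p side (w ++ [x]))) d +
      cycleDist (ofBits (m + 1) (gateBits p side (w ++ [y]))) d = 2 ^ m := by
  rw [← cycleDist_add_cycleDist_antipode (pow_succ' 2 m) (Nat.two_pow_pos m)
    (ofBits (m + 1) (gateBits p side w)) d, gateBits_append_of_all (by simpa using hx),
    gateBits_append_of_all (by simpa using hy), ofBits_append, ofBits_append, length_gateBits, hw]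
  simp [gateBits, ofBits, hsx, hsy]

theorem cycleDist_replicate_false_replicate_true (m : ℕ) :
    cycleDist (ofBits (m + 1) (List.replicate (m + 1) false))
      (ofBits (m + 1) (List.replicate (m + 1) true)) = 1 := by
  have : Fact (1 < 2 ^ (m + 1)) := ⟨Nat.one_lt_two_pow m.succ_ne_zero⟩
  have : 2 ≤ 2 ^ (m + 1) := Nat.le_self_pow m.succ_ne_zero 2
  rw [ofBits_replicate_false, ofBits_replicate_true, two_pow_eq_zero, cycleDist, zero_sub,
    zero_sub, neg_neg, ZMod.valMinAbs_natAbs_eq_min, ZMod.val_one]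
  omega

variable [Fintype V]

theorem wordSum_wordSum_gateDist_suffixProj [DecidableEq V] (z : V) (t : List V) :
    wordSum (m + (z :: t).length) (fun u => wordSum (m + (z :: t).length) fun v =>
        (gateDist p side m (suffixProj (z :: t) u) (suffixProj (z :: t) v) : ℚ)) =
      wordSum m (fun u => wordSum m fun v => (gateDist p side m u v : ℚ)) +
        2 * ((Fintype.card V : ℚ) ^ (m + (z :: t).length) - (Fintype.card V : ℚ) ^ m) *
          wordSum m fun u => (gateDist p side m u (List.replicate m z) : ℚ) := by
  have inner_sum (u : List V) := wordSum_suffixProj m z t fun v => (gateDist p side m u v : ℚ)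
  simp only [inner_sum, wordSum_add, wordSum_const_mul]
  rw [wordSum_suffixProj m z t fun u => (gateDist p side m u (List.replicate m z) : ℚ),
    wordSum_suffixProj m z t fun u => wordSum m fun v => (gateDist p side m u v : ℚ),
    gateDist_self]
  simp only [gateDist_comm (List.replicate m z)]
  push_cast
  ring

variable [DecidableEq V] {a : V × V}

theorem wordSum_cycleDist_gateBits (hfst : side a.1 = false) (hsnd : side a.2 = true)
    (d : ZMod (2 ^ (m + 1))) :
    wordSum (m + 1) (fun u => (cycleDist (ofBits (m + 1) (gateBits (onArc a) side u)) d : ℚ)) =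
      (Fintype.card V : ℚ) ^ m * (2 ^ m +
        ((sideCard side false - 1) * cycleDist (ofBits _ (List.replicate (m + 1) false)) d +
          (sideCard side true - 1) * cycleDist (ofBits _ (List.replicate (m + 1) true)) d)) := by
  have ha : a.1 ≠ a.2 := fun h => by simp [h, hsnd] at hfst
  have fst_onArc : onArc a a.1 := by simp [onArc]
  have snd_onArc : onArc a a.2 := by simp [onArc]
  rw [wordSum_succ', ← wordSum_const, ← sum_not_onArc_comp_side hfst hsnd fun b =>
    (cycleDist (ofBits _ (List.replicate (m + 1) b)) d : ℚ)]
  refine wordSum_congr fun w hw => ?_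
  rw [← sum_onArc_add ha]
  congr 1
  · exact_mod_cast cycleDist_ofBits_append_add hw d fst_onArc snd_onArc hfst hsnd
  · refine Finset.sum_congr rfl fun z hz => ?_
    rw [gateBits_concat (Finset.mem_filter.1 hz).2, hw]

theorem wordSum_cycleDist_gateBits_replicate (hfst : side a.1 = false) (hsnd : side a.2 = true)
    (m : ℕ) (b : Bool) :
    wordSum (m + 1) (fun u => (cycleDist (ofBits _ (gateBits (onArc a) side u))
        (ofBits (m + 1) (List.replicate (m + 1) b)) : ℚ)) =
      (Fintype.card V : ℚ) ^ m * (2 ^ m + (sideCard side (!b) - 1)) := by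
  rw [wordSum_cycleDist_gateBits hfst hsnd]
  cases b <;>
    simp [cycleDist_self, cycleDist_replicate_false_replicate_true,
      cycleDist_comm (ofBits _ (List.replicate (m + 1) true))]

theorem wordSum_wordSum_gateDist (hfst : side a.1 = false) (hsnd : side a.2 = true) (m : ℕ) :
    wordSum (m + 1) (fun u => wordSum (m + 1) fun v =>
        (gateDist (onArc a) side (m + 1) u v : ℚ)) =
      (Fintype.card V : ℚ) ^ (2 * m) * (2 * (Fintype.card V - 1) * 2 ^ m +
        2 * ((sideCard side false - 1) * (sideCard side true - 1))) := by
  simp only [gateDist]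
  rw [wordSum_comm]
  simp only [wordSum_cycleDist_gateBits hfst hsnd]
  simp only [cycleDist_comm (ofBits _ (List.replicate (m + 1) _)), wordSum_const_mul, wordSum_add,
    wordSum_const]
  rw [wordSum_cycleDist_gateBits_replicate hfst hsnd,
    wordSum_cycleDist_gateBits_replicate hfst hsnd, ← sideCard_add side, Bool.not_true,
    Bool.not_false]
  ring

theorem sum_wordSum_gateDist_replicate (hfst : side a.1 = false) (hsnd : side a.2 = true) (m : ℕ) :
    ∑ z with ¬ onArc a z, wordSum (m + 1) (fun u =>
        (gateDist (onArc a) side (m + 1) u (List.replicate (m + 1) z) : ℚ)) =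
      (Fintype.card V : ℚ) ^ m * ((Fintype.card V - 2) * 2 ^ m +
        2 * ((sideCard side false - 1) * (sideCard side true - 1))) := by
  simp only [gateDist, gateBits_replicate, wordSum_cycleDist_gateBits_replicate hfst hsnd]
  rw [sum_not_onArc_comp_side hfst hsnd fun b =>
    (Fintype.card V : ℚ) ^ m * (2 ^ m + (sideCard side (!b) - 1)), ← sideCard_add side,
    Bool.not_true, Bool.not_false]
  ring

end GateDist

section Total

variable {V : Type*} [Fintype V] [DecidableEq V] {G : SimpleGraph V} {o : GraphOrientation G}

theorem sum_schreierCycle (N : ℕ) (F : o.arcs → List V → ℚ) :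
    ∑ c : SchreierCycle o (N + 1), F c.arc c.suffix = ∑ a : o.arcs, (F a [] +
      ∑ l ∈ Finset.range N, ∑ z with ¬ onArc a.1 z, wordSum l fun t => F a (z :: t)) := by
  have sum_suffix (a : o.arcs) (l : ℕ) :
      ∑ s : {s : List.Vector V l // ∀ z ∈ s.toList.head?, ¬ onArc a.1 z}, F a s.1.toList =
        wordSum l fun s => if ∀ z ∈ s.head?, ¬ onArc a.1 z then F a s else 0 := by
    rw [wordSum, ← Finset.sum_filter]
    exact (Finset.sum_subtype _ (by simp) fun s : List.Vector V l => F a s.toList).symm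
  have sum_suffix_succ (a : o.arcs) (l : ℕ) :
      wordSum (l + 1) (fun s => if ∀ z ∈ s.head?, ¬ onArc a.1 z then F a s else 0) =
        ∑ z with ¬ onArc a.1 z, wordSum l fun t => F a (z :: t) := by
    rw [wordSum_succ, Finset.sum_filter]
    refine Finset.sum_congr rfl fun z _ => ?_
    split_ifs with hz <;> simp [hz, wordSum]
  rw [Fintype.sum_equiv SchreierCycle.equivSigma (fun c => F c.arc c.suffix)
    (fun x => F x.1 x.2.2.1.toList) fun c => rfl, Fintype.sum_sigma]
  refine Finset.sum_congr rfl fun a _ => ?_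
  rw [Fintype.sum_sigma]
  simp only [sum_suffix]
  rw [Fin.sum_univ_eq_sum_range (fun l => wordSum l fun s =>
    if ∀ z ∈ s.head?, ¬ onArc a.1 z then F a s else 0), Finset.sum_range_succ', add_comm]
  simp only [sum_suffix_succ, wordSum_zero]
  simp

/-- The sum of the distances of all pairs of words of length `m` along the large cycles. -/
noncomputable def largeCycleSum (o : GraphOrientation G) (m : ℕ) : ℚ :=
  ∑ a : o.arcs, wordSum m fun u => wordSum m fun v =>
    (gateDist (onArc a.1) (farSide G a.1) m u v : ℚ)

/-- The sum of the distances of all words of length `m` along the large cycles to the words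
`z ⋯ z`, where `z` is not an endpoint of the edge of the cycle. -/
noncomputable def attachmentSum (o : GraphOrientation G) (m : ℕ) : ℚ :=
  ∑ a : o.arcs, ∑ z with ¬ onArc a.1 z, wordSum m fun u =>
    (gateDist (onArc a.1) (farSide G a.1) m u (List.replicate m z) : ℚ)

theorem wordSum_wordSum_gateDist_suffixProj_of_length_lt {p side : V → Bool} {N : ℕ} (z : V)
    {t : List V} (ht : t.length < N) :
    wordSum (N + 1) (fun u => wordSum (N + 1) fun v =>
      (gateDist p side (N + 1 - (z :: t).length) (suffixProj (z :: t) u) (suffixProj (z :: t) v)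
        : ℚ)) =
      wordSum (N - t.length) (fun u => wordSum (N - t.length) fun v =>
        (gateDist p side (N - t.length) u v : ℚ)) +
      2 * ((Fintype.card V : ℚ) ^ (N + 1) - (Fintype.card V : ℚ) ^ (N - t.length)) *
        wordSum (N - t.length) fun u =>
          (gateDist p side (N - t.length) u (List.replicate (N - t.length) z) : ℚ) := by
  have length_eq : N - t.length + (z :: t).length = N + 1 := by
    rw [List.length_cons]
    omega
  have h := wordSum_wordSum_gateDist_suffixProj (p := p) (side := side) (m := N - t.length) z t
  rw [length_eq] at h
  rwa [List.length_cons, Nat.add_sub_add_right]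

theorem wordSum_wordSum_sum_cycleDist_position (N : ℕ) :
    wordSum (N + 1) (fun u => wordSum (N + 1) fun v =>
      ∑ c : SchreierCycle o (N + 1), (cycleDist (c.position u) (c.position v) : ℚ)) =
    largeCycleSum o (N + 1) + ∑ l ∈ Finset.range N, (Fintype.card V : ℚ) ^ l *
      (((Fintype.card V : ℚ) - 2) * largeCycleSum o (N - l) +
        2 * ((Fintype.card V : ℚ) ^ (N + 1) - (Fintype.card V : ℚ) ^ (N - l)) *
          attachmentSum o (N - l)) := by
  have sum_not_onArc (a : o.arcs) (x : ℚ) :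
      ∑ z with ¬ onArc a.1 z, x = ((Fintype.card V : ℚ) - 2) * x := by
    have := sum_onArc_add (adj_of_arc a).ne fun _ => x
    simp only [Finset.sum_const, Finset.card_univ, nsmul_eq_mul] at this ⊢
    linear_combination this
  simp only [wordSum_finsetSum]
  refine (sum_schreierCycle N fun a s => wordSum (N + 1) fun u => wordSum (N + 1) fun v =>
    (gateDist (onArc a.1) (farSide G a.1) (N + 1 - s.length) (suffixProj s u) (suffixProj s v)
      : ℚ)).trans ?_
  rw [Finset.sum_add_distrib, Finset.sum_comm]
  congr 1
  refine Finset.sum_congr rfl fun l hl => ?_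
  rw [largeCycleSum, attachmentSum, Finset.mul_sum, Finset.mul_sum, ← Finset.sum_add_distrib,
    Finset.mul_sum]
  refine Finset.sum_congr rfl fun a _ => ?_
  rw [← sum_not_onArc, Finset.mul_sum, ← Finset.sum_add_distrib, Finset.mul_sum]
  refine Finset.sum_congr rfl fun z _ => ?_
  rw [← wordSum_const]
  refine wordSum_congr fun t ht => ?_
  subst ht
  exact wordSum_wordSum_gateDist_suffixProj_of_length_lt z (Finset.mem_range.1 hl)

theorem largeCycleSum_succ (hG : G.IsTree) (o : GraphOrientation G) (m : ℕ) :
    largeCycleSum o (m + 1) = (Fintype.card V : ℚ) ^ (2 * m) *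
      (2 * ((Fintype.card V : ℚ) - 1) ^ 2 * 2 ^ m +
        2 * (wienerIndex G - ((Fintype.card V : ℚ) - 1) ^ 2)) := by
  have sum_arc (a : o.arcs) :=
    wordSum_wordSum_gateDist (farSide_fst a.1) (farSide_snd hG.2 (adj_of_arc a)) m
  rw [largeCycleSum, Finset.sum_congr rfl fun a _ => sum_arc a, ← Finset.mul_sum,
    Finset.sum_add_distrib, Finset.sum_const, ← Finset.mul_sum, sum_sideCard_sub_one hG,
    Finset.card_univ, nsmul_eq_mul, ← card_arcs_add_one hG o]
  push_cast
  ring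

theorem attachmentSum_succ (hG : G.IsTree) (o : GraphOrientation G) (m : ℕ) :
    attachmentSum o (m + 1) = (Fintype.card V : ℚ) ^ m *
      (((Fintype.card V : ℚ) - 1) * ((Fintype.card V : ℚ) - 2) * 2 ^ m +
        2 * (wienerIndex G - ((Fintype.card V : ℚ) - 1) ^ 2)) := by
  have sum_arc (a : o.arcs) :=
    sum_wordSum_gateDist_replicate (farSide_fst a.1) (farSide_snd hG.2 (adj_of_arc a)) m
  rw [attachmentSum, Finset.sum_congr rfl fun a _ => sum_arc a, ← Finset.mul_sum,
    Finset.sum_add_distrib, Finset.sum_const, ← Finset.mul_sum, sum_sideCard_sub_one hG,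
    Finset.card_univ, nsmul_eq_mul, ← card_arcs_add_one hG o]
  push_cast
  ring

end Total

section ClosedForm

theorem mul_sum_range_pow_mul_sub {R : Type*} [CommSemiring R] {k : R} {f g : ℕ → R}
    (hf : ∀ m, f (m + 1) = k ^ m * g m) (N : ℕ) :
    k * ∑ l ∈ Finset.range N, k ^ l * f (N - l) = k ^ N * ∑ m ∈ Finset.range N, g m := by
  rw [← Finset.sum_range_reflect g, Finset.mul_sum, Finset.mul_sum]
  refine Finset.sum_congr rfl fun l hl => ?_
  obtain ⟨j, rfl⟩ := Nat.exists_eq_add_of_lt (Finset.mem_range.1 hl)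
  rw [show l + j + 1 - l = j + 1 by omega, show l + j + 1 - 1 - l = j by omega, hf]
  ring

variable {K : Type*} [Field K] [CharZero K]

theorem sum_two_mul_pow_add_pow_add_two_pow {k : K} (h1 : k ≠ 1) (h2 : 2 * k ≠ 1)
    (x y z c : K) (N : ℕ) :
    ∑ m ∈ Finset.range N, (x * (2 * k) ^ m + y * k ^ m + (z * 2 ^ m + c)) =
      x * (((2 * k) ^ N - 1) / (2 * k - 1)) + y * ((k ^ N - 1) / (k - 1)) +
        (z * (2 ^ N - 1) + N * c) := by
  have two_ne_one : (2 : K) ≠ 1 := by norm_num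
  simp only [Finset.sum_add_distrib, ← Finset.mul_sum, geom_sum_eq h1, geom_sum_eq h2,
    geom_sum_eq two_ne_one, Finset.sum_const, Finset.card_range, nsmul_eq_mul]
  norm_num

end ClosedForm

section WienerIndex

variable {V : Type*} [Fintype V]

theorem wienerIndex_of_subsingleton [Subsingleton V] (G : SimpleGraph V) : wienerIndex G = 0 := by
  have dist_eq_zero (u v : V) : G.dist u v = 0 := by
    rw [Subsingleton.elim u v, SimpleGraph.dist_self]
  simp [wienerIndex, dist_eq_zero]

variable [DecidableEq V] {G : SimpleGraph V}

theorem wienerIndex_simpleSchreierGraph_succ (hG : G.IsTree) (o : GraphOrientation G) (N : ℕ) :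
    wienerIndex ((graphAutomaton o).simpleSchreierGraph (N + 1)) =
      (1 / 2) * (largeCycleSum o (N + 1) +
        ∑ l ∈ Finset.range N, (Fintype.card V : ℚ) ^ l *
          (((Fintype.card V : ℚ) - 2) * largeCycleSum o (N - l) +
            2 * ((Fintype.card V : ℚ) ^ (N + 1) - (Fintype.card V : ℚ) ^ (N - l)) *
              attachmentSum o (N - l))) := by
  rw [wienerIndex, ← wordSum_wordSum_sum_cycleDist_position]
  simp only [(simpleSchreierGraph_connected_and_dist_eq hG o (N + 1)).2, Nat.cast_sum]
  rfl

theorem card_mul_wienerIndex_simpleSchreierGraph_succ (hG : G.IsTree) (o : GraphOrientation G)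
    {k : ℕ} (hk : Fintype.card V = k) (hk1 : k ≠ 1) (N : ℕ) :
    k * wienerIndex ((graphAutomaton o).simpleSchreierGraph (N + 1)) =
      k ^ (2 * N + 1) * ((k - 1) ^ 2 * 2 ^ N + (wienerIndex G - (k - 1) ^ 2)) +
        k ^ N * (-((k - 1) * (k - 2)) * (((2 * k) ^ N - 1) / (2 * k - 1)) +
          -((wienerIndex G - (k - 1) ^ 2) * (k + 2)) * ((k ^ N - 1) / (k - 1)) +
          (k ^ (N + 1) * ((k - 1) * (k - 2)) * (2 ^ N - 1) +
            N * (k ^ (N + 1) * (2 * (wienerIndex G - (k - 1) ^ 2))))) := by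
  have two_mul_ne_one : 2 * (k : ℚ) ≠ 1 := by
    norm_cast
    omega
  have sum_suffix := mul_sum_range_pow_mul_sub (k := (k : ℚ))
    (f := fun m => (k - 2) * largeCycleSum o m +
      2 * ((k : ℚ) ^ (N + 1) - k ^ m) * attachmentSum o m)
    (g := fun m => 2 * (-((k - 1) * (k - 2)) * (2 * k) ^ m +
      -((wienerIndex G - (k - 1) ^ 2) * (k + 2)) * k ^ m +
      (k ^ (N + 1) * ((k - 1) * (k - 2)) * 2 ^ m +
        k ^ (N + 1) * (2 * (wienerIndex G - (k - 1) ^ 2)))))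
    (fun m => by rw [largeCycleSum_succ hG, attachmentSum_succ hG, hk]; ring) N
  rw [← sum_two_mul_pow_add_pow_add_two_pow (by exact_mod_cast hk1) two_mul_ne_one,
    wienerIndex_simpleSchreierGraph_succ hG, hk, mul_left_comm, mul_add, sum_suffix,
    ← Finset.mul_sum, largeCycleSum_succ hG, hk]
  ring

end WienerIndex

end TreeSchreier

theorem mainTheorem1 {V : Type*} [Fintype V] [DecidableEq V] (G : SimpleGraph V) (hG : G.IsTree)
    (o : GraphOrientation G) (k : ℕ) (hk : Fintype.card V = k) (n : ℕ) (hn : 1 ≤ n) :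
    ((graphAutomaton o).simpleSchreierGraph n).Connected ∧
    wienerIndex ((graphAutomaton o).simpleSchreierGraph n) =
      ((k : ℚ) - 1) ^ 2 * (2 * (k : ℚ) ^ 2 - 2 * k - 1) / ((k : ℚ) ^ 3 * (2 * k - 1))
          * (2 ^ n * (k : ℚ) ^ (2 * n))
        - 2 * ((k : ℚ) - 1) ^ 2 / (k : ℚ) ^ 2 * (n * (k : ℚ) ^ (2 * n))
        + 2 * ((k : ℚ) + 1) * ((k : ℚ) - 1) / (k : ℚ) ^ 3 * (k : ℚ) ^ (2 * n)
        - 2 * ((k : ℚ) + 1) * ((k : ℚ) - 1) / ((k : ℚ) * (2 * k - 1)) * (k : ℚ) ^ n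
        + (2 / (k : ℚ) ^ 2 * (n * (k : ℚ) ^ (2 * n))
            - ((k : ℚ) ^ 2 + 2) / ((k : ℚ) ^ 3 * ((k : ℚ) - 1)) * (k : ℚ) ^ (2 * n)
            + ((k : ℚ) + 2) / ((k : ℚ) ^ 2 * ((k : ℚ) - 1)) * (k : ℚ) ^ n) * wienerIndex G := by
  obtain ⟨hconn, -⟩ := TreeSchreier.simpleSchreierGraph_connected_and_dist_eq hG o n
  refine ⟨hconn, ?_⟩
  have : Nonempty V := hG.connected.nonempty
  rcases eq_or_ne k 1 with rfl | hk1
  · have : Subsingleton V := Fintype.card_le_one_iff_subsingleton.1 hk.le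
    have : Subsingleton (List.Vector V n) :=
      Fintype.card_le_one_iff_subsingleton.1 (by simp [card_vector, hk])
    simp [TreeSchreier.wienerIndex_of_subsingleton]
  · obtain ⟨N, rfl⟩ := Nat.exists_eq_add_of_le' hn
    have hk0 : (k : ℚ) ≠ 0 := by exact_mod_cast hk ▸ Fintype.card_ne_zero
    have sub_one_ne_zero : (k : ℚ) - 1 ≠ 0 := sub_ne_zero.2 (by exact_mod_cast hk1)
    have two_mul_sub_one_ne_zero : 2 * (k : ℚ) - 1 ≠ 0 := sub_ne_zero.2 (by norm_cast; omega)
    rw [← mul_right_inj' hk0,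
      TreeSchreier.card_mul_wienerIndex_simpleSchreierGraph_succ hG o hk hk1]
    -- `field_simp` rewrites `2 * k - 1` and then misses that it is nonzero, unless it is an atom.
    generalize hd : 2 * (k : ℚ) - 1 = d at *
    push_cast
    field_simp
    rw [← hd]
    ring
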